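/- Let $\Gamma$ be a finite extensive-form game with a finite non-empty set $\mathcal N$ of strategic players, possibly with chance moves, in which the decision nodes $\mathcal H_i$ of each player $i$ are partitioned into information sets (infosets) $I\in\mathcal I_i$ with common action sets $A_I$, and with utilities $u_i\ge 0$ on the terminal nodes. A strategy $\pi_i$ of player $i$ assigns to each $I\in\mathcal I_i$ a distribution $\pi_i(\cdot\mid I)\in\Delta(A_I)$; a profile is $\pi=(\pi_i)_{i\in\mathcal N}$. Let $\mathbb P(h\mid\pi)$ be the reach probability of a node $h$ from the root, and let $U_i(\pi)=\sum_{z}\mathbb P(z\mid\pi)\,u_i(z)$ (sum over terminal nodes), regarded as a polynomial in the entries $\pi_j(a\mid I)$, with partial derivatives $\nabla_{I,a}U_i$. For an infoset $I$ let $\mathbb P(I\mid\pi)$ be the sum of $\mathbb P(h\mid\pi)$ over those $h\in I$ that have no proper ancestor in $I$, and let $\mathrm{Fr}(I\mid\pi)=\sum_{h\in I}\mathbb P(h\mid\pi)$. Let $\pi_i^{I\mapsto\sigma}$ be the strategy that plays $\sigma\in\Delta(A_I)$ at $I$ and agrees with $\pi_i$ at the other infosets, and let $\pi^{I\mapsto\sigma}=(\pi_i^{I\mapsto\sigma},\pi_{-i})$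 for $I\in\mathcal I_i$. The game has absentmindedness if some path from the root to a terminal node passes through two different nodes of the same infoset. It has perfect recall if, for each player $i$ and any two nodes $h,h'$ of the same infoset of $i$, the sequences of pairs (infoset of $i$, action taken there) along the paths from the root to $h$ and to $h'$ (excluding $h$ and $h'$) are equal. A profile $\pi$ is - a *Nash equilibrium* if $U_i(\pi_i',\pi_{-i})\le U_i(\pi)$ for all $i$ and all strategies $\pi_i'$ of $i$; - an *EDT equilibrium* if $U_i(\pi^{I\mapsto\sigma})\le U_i(\pi)$ for all $i$, $I\in\mathcal I_i$ and $\sigma\in\Delta(A_I)$; - a *CDT equilibrium* if, for all $i$, $\pi_i$ is a Karush–Kuhn–Tucker point of the problem of maximizing $U_i(\cdot,\pi_{-i})$ over the strategies of $i$ (a product of simplices). Put $U_i^{\mathrm{CDT}}(\sigma\mid\pi,I)=U_i(\pi)+\sum_{a\in A_I}(\sigma(a)-\pi_i(a\mid I))\,\nabla_{I,a}U_i(\pi)$ for $I\in\mathcal I_i$. Fix $\pi_{-i}$. A strategy $\tau_i$ of $i$ is *EDT-rational against $\pi_{-i}$* if there are strategies $\tau_i^{(k)}\to\tau_i$ of $i$,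 each with $\tau_i^{(k)}(a\mid I)>0$ for all $I\in\mathcal I_i$ and $a\in A_I$, and reals $\varepsilon^{(k)}>0$ with $\varepsilon^{(k)}\to0$, such that, with $\tau^{(k)}=(\tau_i^{(k)},\pi_{-i})$, $$\frac{1}{\mathbb P(I\mid\tau^{(k)})}\Big(U_i\big((\tau^{(k)})^{I\mapsto\sigma}\big)-U_i(\tau^{(k)})\Big)\le\varepsilon^{(k)}$$ for all $k$, all $I\in\mathcal I_i$ with $\mathbb P(I\mid\tau^{(k)})>0$ and all $\sigma\in\Delta(A_I)$. It is *CDT-rational against $\pi_{-i}$* if the same holds with $\mathrm{Fr}(I\mid\tau^{(k)})$ in place of $\mathbb P(I\mid\tau^{(k)})$ (in both places) and $U_i^{\mathrm{CDT}}(\sigma\mid\tau^{(k)},I)$ in place of $U_i((\tau^{(k)})^{I\mapsto\sigma})$. A profile $\pi$ is an *EDT-Nash* (respectively *CDT-Nash*) *equilibrium* if it is an EDT (respectively CDT) equilibrium and if, for each player $i$, there is a strategy $\tau_i$ that is EDT-rational (respectively CDT-rational) against $\pi_{-i}$ and realization-equivalent to $\pi_i$, that is, $\mathbb P(h\mid(\tau_i,\pi_{-i}))=\mathbb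 P(h\mid\pi)$ for all nodes $h$. **Proposition.** (1) Every EDT-Nash equilibrium of $\Gamma$ is an EDT equilibrium. (2) If $\Gamma$ has no absentmindedness, then a profile is an EDT-Nash equilibrium if and only if it is a CDT-Nash equilibrium. (3) If $\Gamma$ has perfect recall, then a profile is an EDT-Nash equilibrium if and only if it is a Nash equilibrium. -/

import Mathlib

open Filter Topology

noncomputable section

/-- A finite rooted tree whose edges are labelled by actions. A node is identified with the list of
actions on the path that leads to it from the root, the most recent action first; so the root is
`[]`, and `a :: h` is the child of `h` that is reached by the action `a`. -/
structure GameTree (A : Type*) where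
  nodes : Finset (List A)
  root_mem : [] ∈ nodes
  parent_mem : ∀ a h, a :: h ∈ nodes → h ∈ nodes

namespace GameTree

variable {A : Type*} (T : GameTree A)

/-- The set `A_h` of the actions that are available at `h`. -/
def actions (h : List A) : Finset A :=
  T.nodes.preimage (fun a => a :: h) (fun _ _ _ _ e => (List.cons.inj e).1)

/-- `h` is a terminal node. -/
def IsTerminal (h : List A) : Prop := h ∈ T.nodes ∧ T.actions h = ∅

/-- `h` is a nonterminal node. -/
def IsNonterminal (h : List A) : Prop := h ∈ T.nodes ∧ (T.actions h).Nonempty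

open Classical in
/-- The finite set of terminal nodes. -/
def terminals : Finset (List A) := T.nodes.filter T.IsTerminal

end GameTree

/-- An extensive-form game with chance moves, with set `N` of strategic players and with the
infosets of all strategic players indexed (without repetition) by `Info`; the infosets of player `i`
are those `I` with `owner I = i`. A nonterminal node `h` is a chance node if `infoAt h = none`, and
it lies in the infoset `I` (and is assigned to player `owner I`) if `infoAt h = some I`.
The values of `infoAt`, `chance`, `payoff` at other lists are irrelevant. -/
structure ExtensiveGame (N Info A : Type*) extends GameTree A where
  owner : Info → N
  infoAt : List A → Option Info
  /-- infosets are nonempty, as the blocks of a partition -/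
  info_nonempty : ∀ I, ∃ h, toGameTree.IsNonterminal h ∧ infoAt h = some I
  /-- the common action set `A_I` of the nodes of an infoset -/
  act : Info → Finset A
  actions_eq : ∀ h I, toGameTree.IsNonterminal h → infoAt h = some I →
    toGameTree.actions h = act I
  /-- the distribution of the chance player's action at a chance node -/
  chance : List A → A → ℝ
  chance_nonneg : ∀ h, toGameTree.IsNonterminal h → infoAt h = none →
    ∀ a ∈ toGameTree.actions h, 0 ≤ chance h a
  chance_sum : ∀ h, toGameTree.IsNonterminal h → infoAt h = none →
    ∑ a ∈ toGameTree.actions h, chance h a = 1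
  payoff : N → List A → ℝ
  payoff_nonneg : ∀ i z, toGameTree.IsTerminal z → 0 ≤ payoff i z

namespace ExtensiveGame

variable {N Info A : Type*} (G : ExtensiveGame N Info A)

/-! ### Infosets and recall -/

open Classical in
/-- The set of nodes that belong to the infoset `I`. -/
def infoset (I : Info) : Finset (List A) :=
  G.nodes.filter fun h => G.IsNonterminal h ∧ G.infoAt h = some I

/-- The sequence `obs h` of what happened at the nodes strictly before `h` (most recent first): the
infoset of the node (`none` for a chance node) and the action taken there. The acting player is the
owner of the infoset. -/
def obs : List A → List (Option Info × A)
  | [] => []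
  | a :: h => (G.infoAt h, a) :: obs h

open Classical in
/-- The subsequence of `obs h` that consists of the entries of player `i`. -/
def obsOf (i : N) (h : List A) : List (Option Info × A) :=
  (G.obs h).filter fun p => ∃ I, p.1 = some I ∧ G.owner I = i

/-- Player `i` has perfect recall. -/
def PlayerPerfectRecall (i : N) : Prop :=
  ∀ I, G.owner I = i → ∀ h ∈ G.infoset I, ∀ h' ∈ G.infoset I, G.obsOf i h = G.obsOf i h'

/-- All strategic players have perfect recall. -/
def PerfectRecall : Prop := ∀ i, G.PlayerPerfectRecall i

/-- Some infoset appears more than once in `obs h`, for some node `h`. -/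
def HasAbsentmindedness : Prop :=
  ∃ h ∈ G.nodes, ∃ I, List.Duplicate (some I) ((G.obs h).map Prod.fst)

/-! ### Strategies and utilities -/

/-- The set `Δ(A_I)` of randomized actions at `I`: probability distributions on `A_I`, as functions
on `A` that vanish outside of `A_I`. -/
def randomizedActions (I : Info) : Set (A → ℝ) :=
  {σ | (∀ a, 0 ≤ σ a) ∧ (∀ a, a ∉ G.act I → σ a = 0) ∧ ∑ a ∈ G.act I, σ a = 1}

/-- The set `S` of (behavioral) strategy profiles; `π I a` is the probability `π_i(a | I)` for the
owner `i` of `I`, so the strategy `π_i` is the restriction of `π` to the infosets of player `i`. -/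
def profiles : Set (Info → A → ℝ) := {π | ∀ I, π I ∈ G.randomizedActions I}

/-- `τ` has the form `(τ_i, π_{-i})`: only the strategy of player `i` may differ from `π`. -/
def SameOpponents (i : N) (π τ : Info → A → ℝ) : Prop := ∀ I, G.owner I ≠ i → τ I = π I

/-- The probability with which the action `a` is taken at the node `h`. -/
def actionProb (π : Info → A → ℝ) (h : List A) (a : A) : ℝ :=
  match G.infoAt h with
  | none => G.chance h a
  | some I => π I a

/-- The reach probability `P(h | π)` of `h` from the root. As a function of `π` this is a polynomial,
defined for all real values of the coordinates `π I a`. -/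
def reach (π : Info → A → ℝ) : List A → ℝ
  | [] => 1
  | a :: h => reach π h * G.actionProb π h a

/-- The expected utility `U_i(π)`, a polynomial in the coordinates of `π`. -/
def utility (i : N) (π : Info → A → ℝ) : ℝ := ∑ z ∈ G.terminals, G.reach π z * G.payoff i z

open Classical in
/-- The nodes of `I` that are not preceded by a node of `I`. -/
def firstNodes (I : Info) : Finset (List A) :=
  (G.infoset I).filter fun h => some I ∉ (G.obs h).map Prod.fst

/-- The reach probability `P(I | π)` of the infoset `I`. -/
def infoReach (π : Info → A → ℝ) (I : Info) : ℝ := ∑ h ∈ G.firstNodes I, G.reach π h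

/-- The visit frequency `Fr(I | π)` of the infoset `I`. -/
def infoFreq (π : Info → A → ℝ) (I : Info) : ℝ := ∑ h ∈ G.infoset I, G.reach π h

open Classical in
/-- The profile that plays `σ` at `I` and follows `π` elsewhere. -/
def deviate (π : Info → A → ℝ) (I : Info) (σ : A → ℝ) : Info → A → ℝ := Function.update π I σ

open Classical in
/-- The partial derivative `∇_{I,a} U_i` at `π`, in the coordinate `π I a`. -/
def partialUtility (i : N) (π : Info → A → ℝ) (I : Info) (a : A) : ℝ :=
  deriv (fun t : ℝ => G.utility i (Function.update π I (Function.update (π I) a t))) (π I a)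

/-- The utility that causal decision theory assigns to the deviation to `σ` at `I`. -/
def utilityCDT (i : N) (σ : A → ℝ) (π : Info → A → ℝ) (I : Info) : ℝ :=
  G.utility i π + ∑ a ∈ G.act I, (σ a - π I a) * G.partialUtility i π I a

/-! ### Solution concepts -/

/-- `π` is a Nash equilibrium. -/
def IsNash (π : Info → A → ℝ) : Prop :=
  π ∈ G.profiles ∧
    ∀ i, ∀ τ ∈ G.profiles, G.SameOpponents i π τ → G.utility i τ ≤ G.utility i π

/-- `π` is an EDT equilibrium. -/
def IsEDTEquilibrium (π : Info → A → ℝ) : Prop :=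
  π ∈ G.profiles ∧
    ∀ i, ∀ I, G.owner I = i → ∀ σ ∈ G.randomizedActions I,
      G.utility i (deviate π I σ) ≤ G.utility i π

/-- The strategy of player `i` in the profile `π` is a Karush-Kuhn-Tucker point of the problem to
maximize `U_i(·, π_{-i})` subject to `x(I,a) ≥ 0` (multipliers `mu I a`) and `∑ a, x(I,a) = 1`
(multipliers `lam I`), for all infosets `I` of player `i` and all `a` in `A_I`.
Feasibility is part of `π ∈ G.profiles`. -/
def IsKKT (i : N) (π : Info → A → ℝ) : Prop :=
  ∃ (lam : Info → ℝ) (mu : Info → A → ℝ), ∀ I, G.owner I = i → ∀ a ∈ G.act I,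
    0 ≤ mu I a ∧ mu I a * π I a = 0 ∧ G.partialUtility i π I a + mu I a - lam I = 0

/-- `π` is a CDT equilibrium. -/
def IsCDTEquilibrium (π : Info → A → ℝ) : Prop :=
  π ∈ G.profiles ∧ ∀ i, G.IsKKT i π

/-- `π` and `τ` (which differ at most in the strategy of one player) are realization-equivalent:
they induce the same reach probability of every node. -/
def RealizationEquivalent (π τ : Info → A → ℝ) : Prop :=
  ∀ h ∈ G.nodes, G.reach π h = G.reach τ h

/-- The strategy `π_i` is EDT-rational in the single-player perspective of player `i`, where the
other players play the fixed `π_{-i}`. A strategy in that single-player game is the part of player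
`i` in a profile with the same opponents as `π`; the other players act as chance does. -/
def IsEDTRational (i : N) (π : Info → A → ℝ) : Prop :=
  ∃ (p : ℕ → Info → A → ℝ) (ε : ℕ → ℝ),
    (∀ k, p k ∈ G.profiles ∧ G.SameOpponents i π (p k) ∧
      ∀ I, G.owner I = i → ∀ a ∈ G.act I, 0 < p k I a) ∧
    Tendsto p atTop (𝓝 π) ∧
    (∀ k, 0 < ε k) ∧ Tendsto ε atTop (𝓝 0) ∧
    ∀ k, ∀ I, G.owner I = i → 0 < G.infoReach (p k) I → ∀ σ ∈ G.randomizedActions I,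
      1 / G.infoReach (p k) I * (G.utility i (deviate (p k) I σ) - G.utility i (p k)) ≤ ε k

/-- The strategy `π_i` is CDT-rational in the single-player perspective of player `i`, where the
other players play the fixed `π_{-i}`. -/
def IsCDTRational (i : N) (π : Info → A → ℝ) : Prop :=
  ∃ (p : ℕ → Info → A → ℝ) (ε : ℕ → ℝ),
    (∀ k, p k ∈ G.profiles ∧ G.SameOpponents i π (p k) ∧
      ∀ I, G.owner I = i → ∀ a ∈ G.act I, 0 < p k I a) ∧
    Tendsto p atTop (𝓝 π) ∧
    (∀ k, 0 < ε k) ∧ Tendsto ε atTop (𝓝 0) ∧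
    ∀ k, ∀ I, G.owner I = i → 0 < G.infoFreq (p k) I → ∀ σ ∈ G.randomizedActions I,
      1 / G.infoFreq (p k) I * (G.utilityCDT i σ (p k) I - G.utility i (p k)) ≤ ε k

/-- `π` is an EDT-Nash equilibrium. -/
def IsEDTNash (π : Info → A → ℝ) : Prop :=
  G.IsEDTEquilibrium π ∧
    ∀ i, ∃ τ ∈ G.profiles, G.SameOpponents i π τ ∧ G.RealizationEquivalent π τ ∧
      G.IsEDTRational i τ

/-- `π` is a CDT-Nash equilibrium. -/
def IsCDTNash (π : Info → A → ℝ) : Prop :=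
  G.IsCDTEquilibrium π ∧
    ∀ i, ∃ τ ∈ G.profiles, G.SameOpponents i π τ ∧ G.RealizationEquivalent π τ ∧
      G.IsCDTRational i τ

end ExtensiveGame

end

/-!
The first claim holds by definition. The other two rest on the fact that, without absentmindedness,
no path meets an infoset twice, so that utilities are affine in the behaviour at each single infoset
(`exists_utility_deviate_eq`).

Hence `U_i^CDT(σ | π, I) = U_i(π^{I ↦ σ})` and `Fr(I | π) = P(I | π)`, which makes the two notions
of rationality literally the same, and the Karush-Kuhn-Tucker conditions say that `π(· | I)`
maximizes a linear function over a simplex for each `I` (`isKKT_iff`). This is the second claim.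

Perfect recall excludes absentmindedness. For the third claim, let `p` be fully mixed for player `i`
and let `ρ` be another profile with the same opponents. Then
`U_i(ρ) - U_i(p) = ∑ I, r_I * (U_i(p^{I ↦ ρ(I)}) - U_i(p))`, where `r_I` is the ratio of the
probabilities with which player `i` plays towards `I` (`utility_sub_utility_eq_sum`). By perfect
recall `r_I` is well defined and `r_I * P(I | p) = P(I | ρ) ≤ |nodes|`. So if single deviations gain
at most `ε * P(I | p)`, then `ρ` gains at most a constant times `ε`, and the limit of such profiles
`p` is a best response (`IsEDTNash.isNash`).

Conversely, let `π` be a Nash equilibrium. For `δ > 0` consider the strategies of player `i` that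
follow `π` at the infosets which `π` reaches, are arbitrary elsewhere, and are then mixed with the
uniform distribution with weight `δ`. Let `p_δ` be optimal among these and let `τ` be a limit point
for `δ → 0`. It differs from `π` only at unreached infosets, so it is realization-equivalent to `π`.
At a reached infoset, gains at `p_δ` vanish in the limit by continuity and the Nash property. At any
other infoset `I`, optimality of `p_δ` bounds the gain of a deviation by a multiple of `δ` times the
loss from playing uniformly at `I`, which is of order `P(I | p_δ)`
(`utility_sub_utility_deviate_le`); division by `P(I | p_δ)` leaves a bound of order `δ`
(`IsNash.isEDTNash`).
-/

namespace ExtensiveGame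

variable {N Info A : Type*} (G : ExtensiveGame N Info A)

/-! ### Nodes, histories and infosets -/

lemma mem_actions {a : A} {h : List A} : a ∈ G.actions h ↔ a :: h ∈ G.nodes :=
  Finset.mem_preimage

lemma isNonterminal_of_cons_mem {a : A} {h : List A} (ha : a :: h ∈ G.nodes) :
    G.IsNonterminal h :=
  ⟨G.parent_mem a h ha, a, G.mem_actions.2 ha⟩

lemma mem_act_of_cons_mem {a : A} {h : List A} {I : Info} (ha : a :: h ∈ G.nodes)
    (hI : G.infoAt h = some I) : a ∈ G.act I := by
  rw [← G.actions_eq h I (G.isNonterminal_of_cons_mem ha) hI]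
  exact G.mem_actions.2 ha

lemma mem_infoset {I : Info} {h : List A} :
    h ∈ G.infoset I ↔ G.IsNonterminal h ∧ G.infoAt h = some I := by
  simp only [infoset, Finset.mem_filter, and_iff_right_iff_imp]
  exact fun h => h.1.1

lemma mem_firstNodes {I : Info} {h : List A} :
    h ∈ G.firstNodes I ↔ h ∈ G.infoset I ∧ some I ∉ (G.obs h).map Prod.fst := by
  simp [firstNodes]

lemma mem_nodes_of_mem_infoset {I : Info} {h : List A} (hh : h ∈ G.infoset I) : h ∈ G.nodes :=
  (G.mem_infoset.1 hh).1.1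

lemma mem_nodes_of_mem_firstNodes {I : Info} {h : List A} (hh : h ∈ G.firstNodes I) :
    h ∈ G.nodes :=
  G.mem_nodes_of_mem_infoset (G.mem_firstNodes.1 hh).1

lemma mem_nodes_of_mem_terminals {z : List A} (hz : z ∈ G.terminals) : z ∈ G.nodes := by
  simp only [GameTree.terminals, Finset.mem_filter] at hz
  exact hz.1

lemma payoff_nonneg_of_mem {i : N} {z : List A} (hz : z ∈ G.terminals) : 0 ≤ G.payoff i z := by
  simp only [GameTree.terminals, Finset.mem_filter] at hz
  exact G.payoff_nonneg i z hz.2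

lemma infoset_nonempty (I : Info) : (G.infoset I).Nonempty := by
  obtain ⟨h, hh⟩ := G.info_nonempty I
  exact ⟨h, G.mem_infoset.2 hh⟩

lemma act_nonempty (I : Info) : (G.act I).Nonempty := by
  obtain ⟨h, hh, hI⟩ := G.info_nonempty I
  rw [← G.actions_eq h I hh hI]
  exact hh.2

/-- There are finitely many infosets, because they are disjoint nonempty sets of nodes. -/
lemma finite_info (G : ExtensiveGame N Info A) : Finite Info := by
  choose f hf using G.info_nonempty
  refine Finite.of_injective (fun I => (⟨f I, (hf I).1.1⟩ : G.nodes)) fun I J hIJ => ?_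
  have : f I = f J := congrArg Subtype.val hIJ
  exact Option.some.inj (by rw [← (hf I).2, ← (hf J).2, this])

lemma not_mem_obs_of_mem_infoset (hna : ¬ G.HasAbsentmindedness) {I : Info} {h : List A}
    (hh : h ∈ G.infoset I) : some I ∉ (G.obs h).map Prod.fst := by
  intro hmem
  obtain ⟨hn, hI⟩ := G.mem_infoset.1 hh
  obtain ⟨a, ha⟩ := hn.2
  refine hna ⟨a :: h, G.mem_actions.1 ha, I, ?_⟩
  simp only [obs, List.map_cons, hI]
  exact List.Duplicate.cons_mem hmem

lemma firstNodes_eq_infoset (hna : ¬ G.HasAbsentmindedness) (I : Info) :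
    G.firstNodes I = G.infoset I := by
  ext h
  rw [G.mem_firstNodes, and_iff_left_iff_imp]
  exact G.not_mem_obs_of_mem_infoset hna

lemma infoReach_eq_infoFreq (hna : ¬ G.HasAbsentmindedness) (π : Info → A → ℝ) (I : Info) :
    G.infoReach π I = G.infoFreq π I := by
  rw [infoReach, infoFreq, G.firstNodes_eq_infoset hna]

/-! ### Reach probabilities and utilities -/

@[simp] lemma deviate_same (π : Info → A → ℝ) (I : Info) (σ : A → ℝ) : deviate π I σ I = σ := by
  simp [deviate]

lemma deviate_of_ne (π : Info → A → ℝ) {I J : Info} (h : J ≠ I) (σ : A → ℝ) :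
    deviate π I σ J = π J := by
  simp [deviate, h]

@[simp] lemma deviate_self (π : Info → A → ℝ) (I : Info) : deviate π I (π I) = π := by
  simp [deviate]

@[simp] lemma deviate_deviate (π : Info → A → ℝ) (I : Info) (σ σ' : A → ℝ) :
    deviate (deviate π I σ) I σ' = deviate π I σ' := by
  simp [deviate]

variable {G} in
lemma deviate_mem_profiles {π : Info → A → ℝ} (hπ : π ∈ G.profiles) {I : Info} {σ : A → ℝ}
    (hσ : σ ∈ G.randomizedActions I) : deviate π I σ ∈ G.profiles := by
  intro J
  by_cases h : J = I
  · subst h; simpa using hσ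
  · rw [deviate_of_ne π h]; exact hπ J

variable {G} in
lemma SameOpponents.deviate {i : N} {π τ : Info → A → ℝ} (h : G.SameOpponents i π τ) {I : Info}
    (hI : G.owner I = i) (σ : A → ℝ) : G.SameOpponents i π (deviate τ I σ) := by
  intro J hJ
  rw [deviate_of_ne τ (by rintro rfl; exact hJ hI), h J hJ]

lemma sameOpponents_refl (i : N) (π : Info → A → ℝ) : G.SameOpponents i π π := fun _ _ => rfl

variable {G} in
lemma le_one_of_mem_randomizedActions {I : Info} {σ : A → ℝ} (hσ : σ ∈ G.randomizedActions I)
    (a : A) : σ a ≤ 1 := by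
  by_cases ha : a ∈ G.act I
  · rw [← hσ.2.2]
    exact Finset.single_le_sum (fun b _ => hσ.1 b) ha
  · rw [hσ.2.1 a ha]; exact zero_le_one

lemma actionProb_of_some {π : Info → A → ℝ} {h : List A} {I : Info} (hI : G.infoAt h = some I)
    (a : A) : G.actionProb π h a = π I a := by
  simp [actionProb, hI]

lemma actionProb_congr {π τ : Info → A → ℝ} {h : List A} (H : ∀ I, G.infoAt h = some I → π I = τ I)
    (a : A) : G.actionProb π h a = G.actionProb τ h a := by
  unfold actionProb
  split
  · rfl
  · next I hI => rw [H I hI]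

lemma actionProb_mem_Icc {π : Info → A → ℝ} (hπ : π ∈ G.profiles) {a : A} {h : List A}
    (ha : a :: h ∈ G.nodes) : G.actionProb π h a ∈ Set.Icc (0 : ℝ) 1 := by
  unfold actionProb
  have hn := G.isNonterminal_of_cons_mem ha
  have hm := G.mem_actions.2 ha
  split
  · next hI =>
    refine ⟨G.chance_nonneg h hn hI a hm, ?_⟩
    rw [← G.chance_sum h hn hI]
    exact Finset.single_le_sum (G.chance_nonneg h hn hI) hm
  · next I hI => exact ⟨(hπ I).1 a, le_one_of_mem_randomizedActions (hπ I) a⟩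

lemma reach_nonneg {π : Info → A → ℝ} (hπ : π ∈ G.profiles) :
    ∀ {h : List A}, h ∈ G.nodes → 0 ≤ G.reach π h
  | [], _ => zero_le_one
  | a :: h, hh => mul_nonneg (reach_nonneg hπ (G.parent_mem a h hh)) (G.actionProb_mem_Icc hπ hh).1

lemma reach_cons_le {π : Info → A → ℝ} (hπ : π ∈ G.profiles) {a : A} {h : List A}
    (ha : a :: h ∈ G.nodes) : G.reach π (a :: h) ≤ G.reach π h :=
  mul_le_of_le_one_right (G.reach_nonneg hπ (G.parent_mem a h ha)) (G.actionProb_mem_Icc hπ ha).2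

lemma reach_le_one {π : Info → A → ℝ} (hπ : π ∈ G.profiles) :
    ∀ {h : List A}, h ∈ G.nodes → G.reach π h ≤ 1
  | [], _ => le_rfl
  | a :: h, hh => (G.reach_cons_le hπ hh).trans (reach_le_one hπ (G.parent_mem a h hh))

lemma infoReach_nonneg {π : Info → A → ℝ} (hπ : π ∈ G.profiles) (I : Info) :
    0 ≤ G.infoReach π I :=
  Finset.sum_nonneg fun _ hh => G.reach_nonneg hπ (G.mem_nodes_of_mem_firstNodes hh)

lemma infoReach_le_card {π : Info → A → ℝ} (hπ : π ∈ G.profiles) (I : Info) :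
    G.infoReach π I ≤ G.nodes.card := by
  calc G.infoReach π I ≤ ∑ h ∈ G.firstNodes I, (1 : ℝ) :=
        Finset.sum_le_sum fun h hh => G.reach_le_one hπ (G.mem_nodes_of_mem_firstNodes hh)
    _ = (G.firstNodes I).card := by simp
    _ ≤ G.nodes.card := by
        exact_mod_cast Finset.card_le_card fun h hh => G.mem_nodes_of_mem_firstNodes hh

lemma reach_deviate_of_not_mem (π : Info → A → ℝ) (I : Info) (σ : A → ℝ) :
    ∀ {h : List A}, some I ∉ (G.obs h).map Prod.fst → G.reach (deviate π I σ) h = G.reach π h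
  | [], _ => rfl
  | a :: h, hh => by
    simp only [obs, List.map_cons, List.mem_cons, not_or] at hh
    rw [reach, reach, reach_deviate_of_not_mem π I σ hh.2]
    congr 1
    refine G.actionProb_congr (fun J hJ => deviate_of_ne π ?_ σ) a
    rintro rfl
    exact hh.1 hJ.symm

lemma infoReach_deviate (π : Info → A → ℝ) (I : Info) (σ : A → ℝ) :
    G.infoReach (deviate π I σ) I = G.infoReach π I :=
  Finset.sum_congr rfl fun _ hh => G.reach_deviate_of_not_mem π I σ (G.mem_firstNodes.1 hh).2

/-- A node behind `I` is reached with at most the probability of `I`. -/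
lemma reach_le_infoReach {π : Info → A → ℝ} (hπ : π ∈ G.profiles) (I : Info) :
    ∀ {h : List A}, h ∈ G.nodes → some I ∈ (G.obs h).map Prod.fst →
      G.reach π h ≤ G.infoReach π I
  | [], _, hI => by simp [obs] at hI
  | a :: h, hh, hI => by
    have hp := G.parent_mem a h hh
    refine (G.reach_cons_le hπ hh).trans ?_
    by_cases hm : some I ∈ (G.obs h).map Prod.fst
    · exact reach_le_infoReach hπ I hp hm
    · simp only [obs, List.map_cons, List.mem_cons, hm, or_false] at hI
      refine Finset.single_le_sum (f := G.reach π)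
        (fun k hk => G.reach_nonneg hπ (G.mem_nodes_of_mem_firstNodes hk)) ?_
      exact G.mem_firstNodes.2 ⟨G.mem_infoset.2 ⟨G.isNonterminal_of_cons_mem hh, hI.symm⟩, hm⟩

/-- Only the terminal nodes behind `I` feel a deviation at `I`, and payoffs are nonnegative; so the
loss caused by a deviation is at most proportional to the reach probability of `I`. -/
lemma utility_sub_utility_deviate_le {i : N} {π : Info → A → ℝ} (hπ : π ∈ G.profiles) {I : Info}
    {σ : A → ℝ} (hσ : σ ∈ G.randomizedActions I) :
    G.utility i π - G.utility i (deviate π I σ) ≤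
      G.infoReach π I * ∑ z ∈ G.terminals, G.payoff i z := by
  rw [utility, utility, ← Finset.sum_sub_distrib, Finset.mul_sum]
  refine Finset.sum_le_sum fun z hz => ?_
  rw [← sub_mul]
  refine mul_le_mul_of_nonneg_right ?_ (G.payoff_nonneg_of_mem hz)
  have hz' := G.mem_nodes_of_mem_terminals hz
  by_cases hI : some I ∈ (G.obs z).map Prod.fst
  · have h1 := G.reach_le_infoReach hπ I hz' hI
    have h2 := G.reach_nonneg (deviate_mem_profiles hπ hσ) hz'
    linarith
  · rw [G.reach_deviate_of_not_mem π I σ hI, sub_self]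
    exact G.infoReach_nonneg hπ I

lemma utility_deviate_sub_utility_le {i : N} {π : Info → A → ℝ} (hπ : π ∈ G.profiles) {I : Info}
    {σ : A → ℝ} (hσ : σ ∈ G.randomizedActions I) :
    G.utility i (deviate π I σ) - G.utility i π ≤
      G.infoReach π I * ∑ z ∈ G.terminals, G.payoff i z := by
  have := G.utility_sub_utility_deviate_le (i := i) (deviate_mem_profiles hπ hσ) (hπ I)
  rwa [deviate_deviate, deviate_self, infoReach_deviate] at this

variable {G} in
lemma RealizationEquivalent.utility_eq {π τ : Info → A → ℝ} (h : G.RealizationEquivalent π τ)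
    (i : N) : G.utility i π = G.utility i τ :=
  Finset.sum_congr rfl fun z hz => by rw [h z (G.mem_nodes_of_mem_terminals hz)]

lemma continuous_reach : ∀ h : List A, Continuous fun π : Info → A → ℝ => G.reach π h
  | [] => continuous_const
  | a :: h => by
    refine (continuous_reach h).mul ?_
    unfold actionProb
    cases G.infoAt h with
    | none => exact continuous_const
    | some I => exact (continuous_apply a).comp (continuous_apply I)

lemma continuous_utility (i : N) : Continuous fun π : Info → A → ℝ => G.utility i π :=
  continuous_finsetSum _ fun z _ => (G.continuous_reach z).mul continuous_const

lemma continuous_infoReach (I : Info) : Continuous fun π : Info → A → ℝ => G.infoReach π I :=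
  continuous_finsetSum _ fun h _ => G.continuous_reach h

lemma continuous_deviate (I : Info) (σ : A → ℝ) :
    Continuous fun π : Info → A → ℝ => deviate π I σ := by
  refine continuous_pi fun J => ?_
  by_cases hJ : J = I
  · subst hJ
    simpa only [deviate_same] using continuous_const
  · simpa only [deviate_of_ne _ hJ] using continuous_apply J

/-! ### Utilities are affine in each infoset without absentmindedness -/

lemma exists_reach_deviate_eq (hna : ¬ G.HasAbsentmindedness) (π : Info → A → ℝ) (I : Info) :
    ∀ {h : List A}, h ∈ G.nodes → ∃ (c₀ : ℝ) (c : A → ℝ), ∀ σ,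
      G.reach (deviate π I σ) h = c₀ + ∑ a ∈ G.act I, c a * σ a
  | [], _ => ⟨1, 0, fun σ => by simp [reach]⟩
  | a :: h, hh => by
    classical
    by_cases hI : G.infoAt h = some I
    · have hmem : h ∈ G.infoset I := G.mem_infoset.2 ⟨G.isNonterminal_of_cons_mem hh, hI⟩
      refine ⟨0, Pi.single a (G.reach π h), fun σ => ?_⟩
      rw [reach, G.reach_deviate_of_not_mem π I σ (G.not_mem_obs_of_mem_infoset hna hmem),
        G.actionProb_of_some hI, deviate_same, Finset.sum_eq_single a]
      · simp
      · intro b _ hb; simp [hb]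
      · intro h'; exact absurd (G.mem_act_of_cons_mem hh hI) h'
    · obtain ⟨c₀, c, hc⟩ := exists_reach_deviate_eq hna π I (G.parent_mem a h hh)
      refine ⟨c₀ * G.actionProb π h a, fun b => c b * G.actionProb π h a, fun σ => ?_⟩
      rw [reach, hc, G.actionProb_congr (τ := π), add_mul, Finset.sum_mul]
      · congr 1
        exact Finset.sum_congr rfl fun b _ => by ring
      · intro J hJ
        exact deviate_of_ne π (by rintro rfl; exact hI hJ) σ

/-- The utility is affine in the behaviour at each single infoset. -/
lemma exists_utility_deviate_eq (hna : ¬ G.HasAbsentmindedness) (i : N) (π : Info → A → ℝ)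
    (I : Info) : ∃ (c₀ : ℝ) (c : A → ℝ), ∀ σ,
      G.utility i (deviate π I σ) = c₀ + ∑ a ∈ G.act I, c a * σ a := by
  have H : ∀ h, ∃ (c₀ : ℝ) (c : A → ℝ), h ∈ G.nodes → ∀ σ,
      G.reach (deviate π I σ) h = c₀ + ∑ a ∈ G.act I, c a * σ a := by
    intro h
    by_cases hh : h ∈ G.nodes
    · obtain ⟨c₀, c, hc⟩ := G.exists_reach_deviate_eq hna π I hh
      exact ⟨c₀, c, fun _ => hc⟩
    · exact ⟨0, 0, fun h' => absurd h' hh⟩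
  choose c₀ c hc using H
  refine ⟨∑ z ∈ G.terminals, c₀ z * G.payoff i z,
    fun a => ∑ z ∈ G.terminals, c z a * G.payoff i z, fun σ => ?_⟩
  simp_rw [Finset.sum_mul]
  rw [Finset.sum_comm, ← Finset.sum_add_distrib]
  refine Finset.sum_congr rfl fun z hz => ?_
  rw [hc z (G.mem_nodes_of_mem_terminals hz), add_mul, Finset.sum_mul]
  congr 1
  exact Finset.sum_congr rfl fun a _ => by ring

lemma partialUtility_eq {i : N} {π : Info → A → ℝ} {I : Info} {c₀ : ℝ} {c : A → ℝ}
    (hc : ∀ σ, G.utility i (deviate π I σ) = c₀ + ∑ a ∈ G.act I, c a * σ a) {a : A}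
    (ha : a ∈ G.act I) : G.partialUtility i π I a = c a := by
  classical
  have key : (fun t : ℝ => G.utility i (Function.update π I (Function.update (π I) a t))) =
      fun t => c a * t + (c₀ + ∑ b ∈ (G.act I).erase a, c b * π I b) := by
    funext t
    have h1 := hc (Function.update (π I) a t)
    rw [deviate, ← Finset.add_sum_erase _ _ ha, Function.update_self,
      Finset.sum_congr rfl (g := fun b => c b * π I b)] at h1
    · calc _ = G.utility i (Function.update π I (Function.update (π I) a t)) := by congr!
        _ = _ := h1
        _ = _ := by ring
    · intro b hb
      rw [Function.update_of_ne (Finset.ne_of_mem_erase hb)]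
  have hd : HasDerivAt (fun t : ℝ => c a * t + (c₀ + ∑ b ∈ (G.act I).erase a, c b * π I b))
      (c a) (π I a) := by
    simpa using ((hasDerivAt_id (π I a)).const_mul (c a)).add_const
      (c₀ + ∑ b ∈ (G.act I).erase a, c b * π I b)
  rw [partialUtility]
  rw [← key] at hd
  convert hd.deriv

/-- Without absentmindedness, the causal and the evidential utility of a deviation coincide. -/
lemma utilityCDT_eq (hna : ¬ G.HasAbsentmindedness) (i : N) (σ : A → ℝ) (π : Info → A → ℝ)
    (I : Info) : G.utilityCDT i σ π I = G.utility i (deviate π I σ) := by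
  obtain ⟨c₀, c, hc⟩ := G.exists_utility_deviate_eq hna i π I
  have h1 := hc (π I)
  rw [deviate_self] at h1
  rw [utilityCDT, hc, h1, add_assoc, ← Finset.sum_add_distrib]
  congr 1
  refine Finset.sum_congr rfl fun a ha => ?_
  rw [G.partialUtility_eq hc ha]
  ring

/-! ### Causal and evidential rationality without absentmindedness -/

lemma pure_mem_randomizedActions [DecidableEq A] {I : Info} {a : A} (ha : a ∈ G.act I) :
    Pi.single a (1 : ℝ) ∈ G.randomizedActions I := by
  refine ⟨fun b => ?_, fun b hb => ?_, ?_⟩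
  · by_cases h : b = a
    · subst h; simp
    · simp [h]
  · have : b ≠ a := by rintro rfl; exact hb ha
    simp [this]
  · rw [Finset.sum_eq_single a (fun b _ hb => by simp [hb]) fun h => absurd ha h]
    simp

/-- The gain of a deviation is the average of the gains of the pure deviations. -/
lemma utility_deviate_sub_eq_sum [DecidableEq A] (hna : ¬ G.HasAbsentmindedness) (i : N)
    (π : Info → A → ℝ) (I : Info) {σ : A → ℝ} (hσ : σ ∈ G.randomizedActions I) :
    G.utility i (deviate π I σ) - G.utility i π =
      ∑ a ∈ G.act I, σ a * (G.utility i (deviate π I (Pi.single a 1)) - G.utility i π) := by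
  obtain ⟨c₀, c, hc⟩ := G.exists_utility_deviate_eq hna i π I
  have h1 : ∀ a ∈ G.act I, σ a * (G.utility i (deviate π I (Pi.single a 1)) - G.utility i π) =
      σ a * (c₀ - G.utility i π) + c a * σ a := by
    intro a ha
    rw [hc, Finset.sum_eq_single a]
    · simp; ring
    · intro b _ hb; simp [hb]
    · exact fun h => absurd ha h
  rw [Finset.sum_congr rfl h1, Finset.sum_add_distrib, ← Finset.sum_mul, hσ.2.2, hc]
  ring

/-- A profile satisfies the Karush-Kuhn-Tucker conditions if and only if no deviation at a single
infoset helps. In the nontrivial direction, the multiplier of the equality constraint is the average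
of the partial derivatives, which is then their maximum. -/
lemma isKKT_iff (hna : ¬ G.HasAbsentmindedness) {π : Info → A → ℝ} (hπ : π ∈ G.profiles) (i : N) :
    G.IsKKT i π ↔ ∀ I, G.owner I = i → ∀ σ ∈ G.randomizedActions I,
      G.utility i (deviate π I σ) ≤ G.utility i π := by
  classical
  constructor
  · rintro ⟨lam, mu, H⟩ I hI σ hσ
    rw [← G.utilityCDT_eq hna, utilityCDT]
    have h1 : ∀ a ∈ G.act I, (σ a - π I a) * G.partialUtility i π I a ≤
        (σ a - π I a) * lam I := by
      intro a ha
      obtain ⟨h1, h2, h3⟩ := H I hI a ha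
      have h4 : G.partialUtility i π I a = lam I - mu I a := by linarith
      rw [h4]
      nlinarith [mul_nonneg (hσ.1 a) h1]
    have h2 := Finset.sum_le_sum h1
    rw [← Finset.sum_mul, Finset.sum_sub_distrib, hσ.2.2, (hπ I).2.2] at h2
    linarith
  · intro H
    refine ⟨fun I => ∑ a ∈ G.act I, π I a * G.partialUtility i π I a,
      fun I a => ∑ b ∈ G.act I, π I b * G.partialUtility i π I b - G.partialUtility i π I a,
      fun I hI => ?_⟩
    have h0 : ∀ a ∈ G.act I, 0 ≤ ∑ b ∈ G.act I, π I b * G.partialUtility i π I b -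
        G.partialUtility i π I a := by
      intro a ha
      have h1 := H I hI _ (G.pure_mem_randomizedActions ha)
      rw [← G.utilityCDT_eq hna, utilityCDT] at h1
      simp only [sub_mul, Finset.sum_sub_distrib] at h1
      rw [Finset.sum_eq_single (s := G.act I) (f := fun b => (Pi.single a (1 : ℝ) : A → ℝ) b *
        G.partialUtility i π I b) a (fun b _ hb => by simp [hb]) (fun h => absurd ha h)] at h1
      simp only [Pi.single_eq_same, one_mul] at h1
      linarith
    have hsum : ∑ a ∈ G.act I, (∑ b ∈ G.act I, π I b * G.partialUtility i π I b -
        G.partialUtility i π I a) * π I a = 0 := by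
      simp only [sub_mul, Finset.sum_sub_distrib]
      rw [← Finset.mul_sum, (hπ I).2.2, mul_one, sub_eq_zero]
      exact Finset.sum_congr rfl fun a _ => mul_comm _ _
    rw [Finset.sum_eq_zero_iff_of_nonneg fun a ha => mul_nonneg (h0 a ha) ((hπ I).1 a)] at hsum
    exact fun a ha => ⟨h0 a ha, hsum a ha, by ring⟩

theorem isEDTNash_iff_isCDTNash (hna : ¬ G.HasAbsentmindedness) (π : Info → A → ℝ) :
    G.IsEDTNash π ↔ G.IsCDTNash π := by
  have h1 : G.IsEDTEquilibrium π ↔ G.IsCDTEquilibrium π :=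
    and_congr_right fun hπ => forall_congr' fun i => (G.isKKT_iff hna hπ i).symm
  have h2 : ∀ i τ, G.IsEDTRational i τ ↔ G.IsCDTRational i τ := fun i τ => by
    simp only [IsEDTRational, IsCDTRational, G.utilityCDT_eq hna, G.infoReach_eq_infoFreq hna]
  simp only [IsEDTNash, IsCDTNash, h1, h2]

/-! ### Perfect recall -/

lemma mem_map_fst_obs_iff {I : Info} : ∀ {h : List A},
    some I ∈ (G.obs h).map Prod.fst ↔ ∃ a k, a :: k <:+ h ∧ G.infoAt k = some I
  | [] => by simp [obs]
  | b :: h => by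
    simp only [obs, List.map_cons, List.mem_cons, mem_map_fst_obs_iff (h := h)]
    constructor
    · rintro (h1 | ⟨a, k, h1, h2⟩)
      · exact ⟨b, h, List.suffix_rfl, h1.symm⟩
      · exact ⟨a, k, h1.trans (List.suffix_cons b h), h2⟩
    · rintro ⟨a, k, h1, h2⟩
      rcases List.suffix_cons_iff.1 h1 with h3 | h3
      · rw [List.cons.injEq] at h3
        left; rw [← h3.2, h2]
      · exact Or.inr ⟨a, k, h3, h2⟩

lemma mem_nodes_of_suffix {k h : List A} (hk : k <:+ h) (hh : h ∈ G.nodes) : k ∈ G.nodes := by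
  induction h with
  | nil => rwa [List.suffix_nil.1 hk]
  | cons a h ih =>
    rcases List.suffix_cons_iff.1 hk with rfl | h1
    · exact hh
    · exact ih h1 (G.parent_mem a h hh)

lemma obsOf_suffix (i : N) {k h : List A} (hk : k <:+ h) : G.obsOf i k <:+ G.obsOf i h := by
  induction h with
  | nil => rw [List.suffix_nil.1 hk]
  | cons a h ih =>
    rcases List.suffix_cons_iff.1 hk with rfl | h1
    · exact List.suffix_rfl
    · refine (ih h1).trans ?_
      simp only [obsOf, obs]
      exact (List.suffix_cons _ _).filter _

/-- A second visit to an infoset would be preceded by a strictly longer own history than the first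
one. -/
lemma PerfectRecall.not_hasAbsentmindedness {G : ExtensiveGame N Info A} (hpr : G.PerfectRecall) :
    ¬ G.HasAbsentmindedness := by
  rintro ⟨h, hh, I, hdup⟩
  induction h with
  | nil => exact List.not_duplicate_nil _ hdup
  | cons a h ih =>
    simp only [obs, List.map_cons] at hdup
    rw [List.duplicate_cons_iff] at hdup
    rcases hdup with ⟨h1, h2⟩ | h2
    · obtain ⟨b, k, hk, hkI⟩ := G.mem_map_fst_obs_iff.1 h2
      have hhn := G.parent_mem a h hh
      have hmk : k ∈ G.infoset I :=
        G.mem_infoset.2 ⟨G.isNonterminal_of_cons_mem (G.mem_nodes_of_suffix hk hhn), hkI⟩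
      have hmh : h ∈ G.infoset I :=
        G.mem_infoset.2 ⟨G.isNonterminal_of_cons_mem hh, h1⟩
      have heq := hpr (G.owner I) I rfl k hmk h hmh
      have hlen := (G.obsOf_suffix (G.owner I) hk).length_le
      have : G.obsOf (G.owner I) (b :: k) = (some I, b) :: G.obsOf (G.owner I) k := by
        simp [obsOf, obs, hkI]
      rw [this, ← heq, List.length_cons] at hlen
      omega
    · exact ih (G.parent_mem a h hh) h2

/-- The product of the probabilities of the actions of player `i` on the path to a node; it depends
only on the sequence of own infosets and actions. -/
noncomputable def ownProb (i : N) (π : Info → A → ℝ) (h : List A) : ℝ :=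
  ((G.obsOf i h).map fun p => p.1.elim 1 fun I => π I p.2).prod

lemma ownProb_nil (i : N) (π : Info → A → ℝ) : G.ownProb i π [] = 1 := by
  simp [ownProb, obsOf, obs]

lemma ownProb_cons_of_own {i : N} (π : Info → A → ℝ) {h : List A} {I : Info}
    (hI : G.infoAt h = some I) (hi : G.owner I = i) (a : A) :
    G.ownProb i π (a :: h) = π I a * G.ownProb i π h := by
  simp [ownProb, obsOf, obs, hI, hi]

lemma ownProb_cons_of_not_own {i : N} (π : Info → A → ℝ) {h : List A}
    (hI : ∀ I, G.infoAt h = some I → G.owner I ≠ i) (a : A) :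
    G.ownProb i π (a :: h) = G.ownProb i π h := by
  have : ¬ ∃ I, G.infoAt h = some I ∧ G.owner I = i := by
    rintro ⟨I, h1, h2⟩; exact hI I h1 h2
  simp [ownProb, obsOf, obs, this]

lemma ownProb_pos {i : N} {π : Info → A → ℝ}
    (hpos : ∀ I, G.owner I = i → ∀ a ∈ G.act I, 0 < π I a) :
    ∀ {h : List A}, h ∈ G.nodes → 0 < G.ownProb i π h
  | [], _ => by rw [ownProb_nil]; exact one_pos
  | a :: h, hh => by
    have ih := ownProb_pos hpos (G.parent_mem a h hh)
    by_cases H : ∃ I, G.infoAt h = some I ∧ G.owner I = i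
    · obtain ⟨I, h1, h2⟩ := H
      rw [G.ownProb_cons_of_own π h1 h2]
      exact mul_pos (hpos I h2 a (G.mem_act_of_cons_mem hh h1)) ih
    · push Not at H
      rwa [G.ownProb_cons_of_not_own π H]

lemma ownProb_nonneg {i : N} {π : Info → A → ℝ} (hπ : π ∈ G.profiles) (h : List A) :
    0 ≤ G.ownProb i π h := by
  refine List.prod_nonneg fun x hx => ?_
  obtain ⟨⟨o, a⟩, -, rfl⟩ := List.mem_map.1 hx
  cases o with
  | none => exact zero_le_one
  | some I => exact (hπ I).1 a

/-- Reach probabilities factor into a part of player `i` and a part of the others. -/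
lemma reach_mul_ownProb {i : N} {π τ : Info → A → ℝ} (h : G.SameOpponents i π τ) :
    ∀ k : List A, G.reach τ k * G.ownProb i π k = G.reach π k * G.ownProb i τ k
  | [] => by simp [reach, ownProb_nil]
  | a :: k => by
    have ih := reach_mul_ownProb h k
    by_cases H : ∃ I, G.infoAt k = some I ∧ G.owner I = i
    · obtain ⟨I, h1, h2⟩ := H
      rw [G.ownProb_cons_of_own π h1 h2, G.ownProb_cons_of_own τ h1 h2, reach, reach,
        G.actionProb_of_some h1, G.actionProb_of_some h1]
      linear_combination (τ I a * π I a) * ih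
    · push Not at H
      rw [G.ownProb_cons_of_not_own π H, G.ownProb_cons_of_not_own τ H, reach, reach,
        G.actionProb_congr (π := τ) (τ := π) fun I hI => h I (H I hI)]
      linear_combination (G.actionProb π k a) * ih

/-- The ratio of the probabilities with which player `i` plays towards the infoset `I` under `τ` and
under `π`. Under perfect recall it does not depend on the node of `I` that is chosen here. -/
noncomputable def ownRatio (i : N) (π τ : Info → A → ℝ) (I : Info) : ℝ :=
  G.ownProb i τ (G.infoset_nonempty I).choose / G.ownProb i π (G.infoset_nonempty I).choose

lemma ownRatio_mul_reach {i : N} (hpr : G.PlayerPerfectRecall i) {π τ : Info → A → ℝ}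
    (h : G.SameOpponents i π τ) (hpos : ∀ I, G.owner I = i → ∀ a ∈ G.act I, 0 < π I a) {I : Info}
    (hI : G.owner I = i) {k : List A} (hk : k ∈ G.infoset I) :
    G.ownRatio i π τ I * G.reach π k = G.reach τ k := by
  have hc := (G.infoset_nonempty I).choose_spec
  have hobs := hpr I hI _ hc k hk
  have h1 : ∀ ρ : Info → A → ℝ,
      G.ownProb i ρ (G.infoset_nonempty I).choose = G.ownProb i ρ k := fun ρ => by
    rw [ownProb, ownProb, hobs]
  have h2 := G.ownProb_pos hpos (G.mem_nodes_of_mem_infoset hk)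
  rw [ownRatio, h1, h1, div_mul_eq_mul_div, div_eq_iff h2.ne', G.reach_mul_ownProb h k, mul_comm]

/-- A change of the whole strategy of player `i` is a weighted sum of changes at single infosets. At
a node of an infoset `J` the earlier changes sum up by induction, and the change at `J` contributes
with the reach probability of the node under the new strategy. -/
lemma reach_sub_reach_eq_sum [Fintype Info] {i : N} (hpr : G.PlayerPerfectRecall i)
    (hna : ¬ G.HasAbsentmindedness) {π τ : Info → A → ℝ} (h : G.SameOpponents i π τ)
    (hpos : ∀ I, G.owner I = i → ∀ a ∈ G.act I, 0 < π I a) :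
    ∀ {k : List A}, k ∈ G.nodes → G.reach τ k - G.reach π k =
      ∑ I, G.ownRatio i π τ I * (G.reach (deviate π I (τ I)) k - G.reach π k)
  | [], _ => by simp [reach]
  | a :: k, hk => by
    classical
    have ih := reach_sub_reach_eq_sum hpr hna h hpos (G.parent_mem a k hk)
    by_cases H : ∃ J, G.infoAt k = some J ∧ G.owner J = i
    · obtain ⟨J, h1, h2⟩ := H
      have hmem : k ∈ G.infoset J := G.mem_infoset.2 ⟨G.isNonterminal_of_cons_mem hk, h1⟩
      have hnot := G.not_mem_obs_of_mem_infoset hna hmem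
      have h3 := G.ownRatio_mul_reach hpr h hpos h2 hmem
      rw [← Finset.add_sum_erase _ _ (Finset.mem_univ J)] at ih ⊢
      rw [G.reach_deviate_of_not_mem π J _ hnot, sub_self, mul_zero, zero_add] at ih
      have h4 : ∑ I ∈ Finset.univ.erase J, G.ownRatio i π τ I *
          (G.reach (deviate π I (τ I)) (a :: k) - G.reach π (a :: k)) =
          (G.reach τ k - G.reach π k) * π J a := by
        rw [ih, Finset.sum_mul]
        refine Finset.sum_congr rfl fun I hI => ?_
        rw [reach, reach, G.actionProb_of_some h1, G.actionProb_of_some h1,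
          deviate_of_ne π (Finset.ne_of_mem_erase hI).symm]
        ring
      rw [h4, reach, reach, reach, G.actionProb_of_some h1, G.actionProb_of_some h1,
        G.actionProb_of_some h1, deviate_same, G.reach_deviate_of_not_mem π J _ hnot]
      linear_combination -(τ J a - π J a) * h3
    · push Not at H
      have h3 : ∀ I, G.actionProb (deviate π I (τ I)) k a = G.actionProb π k a := fun I =>
        G.actionProb_congr (fun J hJ => by
          by_cases hIJ : J = I
          · subst hIJ; rw [deviate_same, h J (H J hJ)]
          · rw [deviate_of_ne π hIJ]) a
      simp only [reach, h3]
      rw [G.actionProb_congr (π := τ) (τ := π) fun I hI => h I (H I hI), ← sub_mul, ih,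
        Finset.sum_mul]
      exact Finset.sum_congr rfl fun I _ => by ring

lemma utility_sub_utility_eq_sum [Fintype Info] {i : N} (hpr : G.PlayerPerfectRecall i)
    (hna : ¬ G.HasAbsentmindedness) {π τ : Info → A → ℝ} (h : G.SameOpponents i π τ)
    (hpos : ∀ I, G.owner I = i → ∀ a ∈ G.act I, 0 < π I a) :
    G.utility i τ - G.utility i π =
      ∑ I, G.ownRatio i π τ I * (G.utility i (deviate π I (τ I)) - G.utility i π) := by
  simp only [utility, ← Finset.sum_sub_distrib, ← sub_mul, Finset.mul_sum]
  rw [Finset.sum_comm]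
  refine Finset.sum_congr rfl fun z hz => ?_
  rw [G.reach_sub_reach_eq_sum hpr hna h hpos (G.mem_nodes_of_mem_terminals hz), Finset.sum_mul]
  exact Finset.sum_congr rfl fun I _ => by ring

theorem IsEDTNash.isNash {G : ExtensiveGame N Info A} (hpr : G.PerfectRecall)
    {π : Info → A → ℝ} (hπ : G.IsEDTNash π) : G.IsNash π := by
  have hna := hpr.not_hasAbsentmindedness
  have := G.finite_info
  have := Fintype.ofFinite Info
  refine ⟨hπ.1.1, fun i ρ hρ hρπ => ?_⟩
  obtain ⟨τ, -, hτπ, hreal, p, ε, hp, hlim, hε, hε0, hrat⟩ := hπ.2 i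
  rw [hreal.utility_eq]
  have key : ∀ k, G.utility i ρ - G.utility i (p k) ≤
      Fintype.card Info * (ε k * G.nodes.card) := by
    intro k
    obtain ⟨hk, hkτ, hpos⟩ := hp k
    have hso : G.SameOpponents i (p k) ρ := fun I hI => by
      rw [hρπ I hI, hkτ I hI, hτπ I hI]
    rw [G.utility_sub_utility_eq_sum (hpr i) hna hso hpos, ← nsmul_eq_mul]
    refine Finset.sum_le_card_nsmul _ _ _ fun I _ => ?_
    have hb : 0 ≤ ε k * G.nodes.card := mul_nonneg (hε k).le (Nat.cast_nonneg _)
    by_cases hI : G.owner I = i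
    · have hr : 0 ≤ G.ownRatio i (p k) ρ I :=
        div_nonneg (G.ownProb_nonneg hρ _) (G.ownProb_nonneg hk _)
      have hinfo : G.ownRatio i (p k) ρ I * G.infoReach (p k) I = G.infoReach ρ I := by
        rw [infoReach, infoReach, Finset.mul_sum]
        exact Finset.sum_congr rfl fun h hh =>
          G.ownRatio_mul_reach (hpr i) hso hpos hI (G.mem_firstNodes.1 hh).1
      rcases (G.infoReach_nonneg hk I).eq_or_lt with h0 | h0
      · have := G.utility_deviate_sub_utility_le (i := i) hk (hρ I)
        rw [← h0, zero_mul] at this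
        exact (mul_nonpos_of_nonneg_of_nonpos hr this).trans hb
      · have h1 := hrat k I hI h0 (ρ I) (hρ I)
        rw [one_div, inv_mul_le_iff₀ h0] at h1
        calc _ ≤ G.ownRatio i (p k) ρ I * (G.infoReach (p k) I * ε k) :=
              mul_le_mul_of_nonneg_left h1 hr
          _ = ε k * G.infoReach ρ I := by rw [← mul_assoc, hinfo, mul_comm]
          _ ≤ ε k * G.nodes.card :=
              mul_le_mul_of_nonneg_left (G.infoReach_le_card hρ I) (hε k).le
    · rw [hso I hI, deviate_self, sub_self, mul_zero]
      exact hb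
  have h1 : Tendsto (fun k => G.utility i ρ - G.utility i (p k)) atTop
      (𝓝 (G.utility i ρ - G.utility i τ)) :=
    tendsto_const_nhds.sub (((G.continuous_utility i).tendsto τ).comp hlim)
  have h2 : Tendsto (fun k => Fintype.card Info * (ε k * G.nodes.card)) atTop (𝓝 (0 : ℝ)) := by
    simpa using (hε0.mul_const (G.nodes.card : ℝ)).const_mul (Fintype.card Info : ℝ)
  linarith [le_of_tendsto_of_tendsto' h1 h2 key]

/-! ### Nash equilibria as limits of constrained optima -/

lemma isCompact_randomizedActions (I : Info) : IsCompact (G.randomizedActions I) := by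
  refine IsCompact.of_isClosed_subset
    (isCompact_univ_pi fun _ : A => isCompact_Icc (a := (0 : ℝ)) (b := 1)) ?_
    fun σ hσ a _ => ⟨hσ.1 a, le_one_of_mem_randomizedActions hσ a⟩
  have hset : G.randomizedActions I = (⋂ a, {σ : A → ℝ | 0 ≤ σ a}) ∩
      ((⋂ a, ⋂ (_ : a ∉ G.act I), {σ | σ a = 0}) ∩ {σ | ∑ a ∈ G.act I, σ a = 1}) := by
    ext σ
    simp [randomizedActions]
  rw [hset]
  exact (isClosed_iInter fun a => isClosed_le continuous_const (continuous_apply a)).inter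
    ((isClosed_iInter fun a => isClosed_iInter fun _ =>
      isClosed_eq (continuous_apply a) continuous_const).inter
    (isClosed_eq (continuous_finsetSum _ fun a _ => continuous_apply a) continuous_const))

lemma isCompact_profiles : IsCompact G.profiles := by
  have hset : G.profiles = Set.pi Set.univ G.randomizedActions := by
    ext π
    simp [profiles]
  rw [hset]
  exact isCompact_univ_pi G.isCompact_randomizedActions

/-- A sequence in a compact set of profiles has a convergent subsequence. The space of all profiles
need not be first countable, as `A` may be infinite, but only finitely many actions are used. -/
lemma exists_tendsto_subseq {T : Set (Info → A → ℝ)} (hT : IsCompact T) (hTp : T ⊆ G.profiles)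
    {t : ℕ → Info → A → ℝ} (ht : ∀ k, t k ∈ T) :
    ∃ τ ∈ T, ∃ φ : ℕ → ℕ, StrictMono φ ∧ Tendsto (t ∘ φ) atTop (𝓝 τ) := by
  classical
  have := G.finite_info
  have := Fintype.ofFinite Info
  let S : Finset A := Finset.univ.biUnion G.act
  let r : (Info → A → ℝ) → Info → S → ℝ := fun π I a => π I a
  have hr : Continuous r := by fun_prop
  obtain ⟨_, ⟨τ, hτ, rfl⟩, φ, hφ, hlim⟩ :=
    (hT.image hr).tendsto_subseq fun k => Set.mem_image_of_mem r (ht k)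
  refine ⟨τ, hτ, φ, hφ, ?_⟩
  rw [tendsto_pi_nhds]
  intro I
  rw [tendsto_pi_nhds]
  intro a
  by_cases ha : a ∈ S
  · exact tendsto_pi_nhds.1 (tendsto_pi_nhds.1 hlim I) ⟨a, ha⟩
  · have ha' : a ∉ G.act I := fun h => ha (Finset.mem_biUnion.2 ⟨I, Finset.mem_univ I, h⟩)
    rw [(hTp hτ I).2.1 a ha']
    refine tendsto_const_nhds.congr fun k => ?_
    exact ((hTp (ht (φ k)) I).2.1 a ha').symm

open Classical in
/-- The uniform distribution on the actions at `I`. -/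
noncomputable def uniform (I : Info) (a : A) : ℝ :=
  if a ∈ G.act I then ((G.act I).card : ℝ)⁻¹ else 0

lemma uniform_mem_randomizedActions (I : Info) : G.uniform I ∈ G.randomizedActions I := by
  refine ⟨fun a => ?_, fun a ha => by simp [uniform, ha], ?_⟩
  · unfold uniform; split <;> positivity
  · have : ((G.act I).card : ℝ) ≠ 0 := by simpa using (G.act_nonempty I).ne_empty
    rw [Finset.sum_congr rfl (g := fun _ => ((G.act I).card : ℝ)⁻¹)
      fun a ha => by simp [uniform, ha]]
    simp [this]

lemma uniform_pos {I : Info} {a : A} (ha : a ∈ G.act I) : 0 < G.uniform I a := by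
  have : 0 < (G.act I).card := Finset.card_pos.2 ⟨a, ha⟩
  simp only [uniform, ha, if_true]
  positivity

lemma convexComb_mem_randomizedActions {I : Info} {σ σ' : A → ℝ}
    (hσ : σ ∈ G.randomizedActions I) (hσ' : σ' ∈ G.randomizedActions I) {δ : ℝ} (h0 : 0 ≤ δ)
    (h1 : δ ≤ 1) : (1 - δ) • σ + δ • σ' ∈ G.randomizedActions I := by
  refine ⟨fun a => ?_, fun a ha => ?_, ?_⟩
  · exact add_nonneg (mul_nonneg (by linarith) (hσ.1 a)) (mul_nonneg h0 (hσ'.1 a))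
  · simp [hσ.2.1 a ha, hσ'.2.1 a ha]
  · simp only [Pi.add_apply, Pi.smul_apply, smul_eq_mul]
    rw [Finset.sum_add_distrib, ← Finset.mul_sum, ← Finset.mul_sum, hσ.2.2, hσ'.2.2]
    ring

open Classical in
/-- Player `i` trembles with probability `δ` at each own infoset, uniformly over the actions. -/
noncomputable def tremble (i : N) (δ : ℝ) (t : Info → A → ℝ) (I : Info) : A → ℝ :=
  if G.owner I = i then (1 - δ) • t I + δ • G.uniform I else t I

lemma tremble_of_own {i : N} {I : Info} (hI : G.owner I = i) (δ : ℝ) (t : Info → A → ℝ) :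
    G.tremble i δ t I = (1 - δ) • t I + δ • G.uniform I := by
  simp [tremble, hI]

lemma tremble_mem_profiles {i : N} {δ : ℝ} (h0 : 0 ≤ δ) (h1 : δ ≤ 1) {t : Info → A → ℝ}
    (ht : t ∈ G.profiles) : G.tremble i δ t ∈ G.profiles := by
  intro I
  unfold tremble
  split
  · exact G.convexComb_mem_randomizedActions (ht I) (G.uniform_mem_randomizedActions I) h0 h1
  · exact ht I

lemma tremble_deviate {i : N} {I : Info} (hI : G.owner I = i) (δ : ℝ) (t : Info → A → ℝ)
    (σ : A → ℝ) : G.tremble i δ (deviate t I σ) =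
      deviate (G.tremble i δ t) I ((1 - δ) • σ + δ • G.uniform I) := by
  funext J
  by_cases hJ : J = I
  · subst hJ; rw [deviate_same, G.tremble_of_own hI, deviate_same]
  · rw [deviate_of_ne _ hJ]; simp only [tremble, deviate_of_ne _ hJ]

lemma continuous_tremble (i : N) :
    Continuous fun x : ℝ × (Info → A → ℝ) => G.tremble i x.1 x.2 := by
  refine continuous_pi fun I => ?_
  unfold tremble
  split <;> fun_prop

lemma utility_deviate_convexComb (hna : ¬ G.HasAbsentmindedness) (i : N) (π : Info → A → ℝ)
    (I : Info) (σ σ' : A → ℝ) (δ : ℝ) :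
    G.utility i (deviate π I ((1 - δ) • σ + δ • σ')) =
      (1 - δ) * G.utility i (deviate π I σ) + δ * G.utility i (deviate π I σ') := by
  obtain ⟨c₀, c, hc⟩ := G.exists_utility_deviate_eq hna i π I
  simp only [hc, Pi.add_apply, Pi.smul_apply, smul_eq_mul, mul_add, Finset.sum_add_distrib,
    Finset.mul_sum, mul_left_comm (c _)]
  ring

/-- Rationality need only be tested on pure deviations, one at a time. -/
lemma isEDTRational_of_pure [DecidableEq A] (hna : ¬ G.HasAbsentmindedness) {i : N}
    {τ : Info → A → ℝ} (p : ℕ → Info → A → ℝ)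
    (hp : ∀ k, p k ∈ G.profiles ∧ G.SameOpponents i τ (p k) ∧
      ∀ I, G.owner I = i → ∀ a ∈ G.act I, 0 < p k I a)
    (hlim : Tendsto p atTop (𝓝 τ))
    (hrat : ∀ I, G.owner I = i → ∀ a ∈ G.act I, Tendsto (fun k => max 0 (1 / G.infoReach (p k) I *
      (G.utility i (deviate (p k) I (Pi.single a 1)) - G.utility i (p k)))) atTop (𝓝 0)) :
    G.IsEDTRational i τ := by
  classical
  have := G.finite_info
  have := Fintype.ofFinite Info
  let g : Info → A → ℕ → ℝ := fun I a k => max 0 (1 / G.infoReach (p k) I *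
    (G.utility i (deviate (p k) I (Pi.single a 1)) - G.utility i (p k)))
  have hg : ∀ I a k, 0 ≤ g I a k := fun I a k => le_max_left _ _
  let s : Finset Info := Finset.univ.filter fun I => G.owner I = i
  have hsum : ∀ k, 0 ≤ ∑ I ∈ s, ∑ a ∈ G.act I, g I a k := fun k =>
    Finset.sum_nonneg fun I _ => Finset.sum_nonneg fun a _ => hg I a k
  refine ⟨p, fun k => 1 / ((k : ℝ) + 1) + ∑ I ∈ s, ∑ a ∈ G.act I, g I a k, hp, hlim,
    fun k => add_pos_of_pos_of_nonneg (by positivity) (hsum k), ?_, ?_⟩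
  · have h1 : Tendsto (fun k => ∑ I ∈ s, ∑ a ∈ G.act I, g I a k) atTop
        (𝓝 (∑ I ∈ s, ∑ a ∈ G.act I, (0 : ℝ))) :=
      tendsto_finsetSum _ fun I hI => tendsto_finsetSum _ fun a ha =>
        hrat I (Finset.mem_filter.1 hI).2 a ha
    simpa using tendsto_one_div_add_atTop_nhds_zero_nat.add h1
  · intro k I hI _ σ hσ
    rw [G.utility_deviate_sub_eq_sum hna i (p k) I hσ, Finset.mul_sum]
    have h1 : ∀ a ∈ G.act I, 1 / G.infoReach (p k) I *
        (σ a * (G.utility i (deviate (p k) I (Pi.single a 1)) - G.utility i (p k))) ≤ g I a k := by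
      intro a _
      rw [mul_left_comm]
      calc _ ≤ σ a * g I a k := mul_le_mul_of_nonneg_left (le_max_right _ _) (hσ.1 a)
        _ ≤ g I a k := mul_le_of_le_one_left (hg I a k) (le_one_of_mem_randomizedActions hσ a)
    have h2 : ∑ a ∈ G.act I, g I a k ≤ ∑ I ∈ s, ∑ a ∈ G.act I, g I a k :=
      Finset.single_le_sum (f := fun I => ∑ a ∈ G.act I, g I a k)
        (fun J _ => Finset.sum_nonneg fun a _ => hg J a k)
        (Finset.mem_filter.2 ⟨Finset.mem_univ I, hI⟩)
    have h3 : (0 : ℝ) ≤ 1 / ((k : ℝ) + 1) := by positivity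
    linarith [Finset.sum_le_sum h1]

/-- Changes at unreached infosets do not affect the reach probabilities. -/
lemma realizationEquivalent_of_eqOn_reached (hna : ¬ G.HasAbsentmindedness) {π τ : Info → A → ℝ}
    (hπ : π ∈ G.profiles) (h : ∀ I, 0 < G.infoReach π I → τ I = π I) :
    G.RealizationEquivalent π τ := by
  intro k hk
  induction k with
  | nil => rfl
  | cons a k ih =>
    rw [reach, reach, ← ih (G.parent_mem a k hk)]
    rcases (G.reach_nonneg hπ (G.parent_mem a k hk)).eq_or_lt with h0 | h0
    · rw [← h0, zero_mul, zero_mul]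
    · congr 1
      refine G.actionProb_congr (fun I hI => (h I ?_).symm) a
      have hm : k ∈ G.infoset I := G.mem_infoset.2 ⟨G.isNonterminal_of_cons_mem hk, hI⟩
      rw [← G.firstNodes_eq_infoset hna] at hm
      exact h0.trans_le (Finset.single_le_sum (f := G.reach π)
        (fun l hl => G.reach_nonneg hπ (G.mem_nodes_of_mem_firstNodes hl)) hm)

theorem IsNash.isEDTNash {G : ExtensiveGame N Info A} (hna : ¬ G.HasAbsentmindedness)
    {π : Info → A → ℝ} (hN : G.IsNash π) : G.IsEDTNash π := by
  classical
  obtain ⟨hπ, hbest⟩ := hN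
  refine ⟨⟨hπ, fun i I hI σ hσ => hbest i _ (deviate_mem_profiles hπ hσ)
    ((G.sameOpponents_refl i π).deviate hI σ)⟩, fun i => ?_⟩
  -- Player `i` keeps `π` where it is reached, and is free to reoptimize elsewhere.
  let T : Set (Info → A → ℝ) :=
    {t | t ∈ G.profiles ∧ ∀ I, (G.owner I ≠ i ∨ 0 < G.infoReach π I) → t I = π I}
  have hTc : IsCompact T := by
    refine G.isCompact_profiles.inter_right (t := {t | ∀ I, (G.owner I ≠ i ∨
      0 < G.infoReach π I) → t I = π I}) ?_
    simp only [Set.ofPred_forall]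
    exact isClosed_iInter fun I => isClosed_iInter fun _ =>
      isClosed_eq (continuous_apply I) continuous_const
  let δ : ℕ → ℝ := fun k => 1 / ((k : ℝ) + 2)
  have hδ0 : ∀ k, 0 < δ k := fun k => by positivity
  have hδ1 : ∀ k, δ k ≤ 1 / 2 := fun k => by
    refine one_div_le_one_div_of_le two_pos ?_
    have : (0 : ℝ) ≤ k := Nat.cast_nonneg k
    linarith
  have hδlim : Tendsto δ atTop (𝓝 0) := by
    have := (tendsto_one_div_add_atTop_nhds_zero_nat (𝕜 := ℝ)).comp (tendsto_add_atTop_nat 1)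
    refine this.congr fun k => ?_
    simp only [Function.comp, δ]
    push_cast
    ring
  have hmax : ∀ k, ∃ t ∈ T, ∀ s ∈ T,
      G.utility i (G.tremble i (δ k) s) ≤ G.utility i (G.tremble i (δ k) t) := fun k =>
    hTc.exists_isMaxOn ⟨π, hπ, fun _ _ => rfl⟩ (((G.continuous_utility i).comp
      ((G.continuous_tremble i).comp (continuous_const.prodMk continuous_id))).continuousOn)
  choose t htT htmax using hmax
  obtain ⟨τ, hτT, φ, hφ, hlim⟩ := G.exists_tendsto_subseq hTc (fun t ht => ht.1) htT
  have hso : G.SameOpponents i π τ := fun I hI => hτT.2 I (Or.inl hI)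
  have hreal : G.RealizationEquivalent π τ :=
    G.realizationEquivalent_of_eqOn_reached hna hπ fun I hI => hτT.2 I (Or.inr hI)
  refine ⟨τ, hτT.1, hso, hreal, ?_⟩
  let p : ℕ → Info → A → ℝ := fun k => G.tremble i (δ (φ k)) (t (φ k))
  have hplim : Tendsto p atTop (𝓝 τ) := by
    have h1 := ((G.continuous_tremble i).tendsto (0, τ)).comp
      ((hδlim.comp hφ.tendsto_atTop).prodMk_nhds hlim)
    have h2 : G.tremble i 0 τ = τ := by
      funext I
      simp [tremble]
    rw [h2] at h1
    exact h1
  have hpp : ∀ k, p k ∈ G.profiles := fun k =>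
    G.tremble_mem_profiles (hδ0 _).le ((hδ1 _).trans (by norm_num)) (htT _).1
  refine G.isEDTRational_of_pure hna p (fun k => ⟨hpp k, fun I hI => ?_, fun I hI a ha => ?_⟩)
    hplim fun I hI a ha => ?_
  · simp only [p, tremble, hI, if_false]
    rw [(htT _).2 I (Or.inl hI), hso I hI]
  · simp only [p, G.tremble_of_own hI, Pi.add_apply, Pi.smul_apply, smul_eq_mul]
    refine add_pos_of_nonneg_of_pos (mul_nonneg ?_ (((htT _).1 I).1 a))
      (mul_pos (hδ0 _) (G.uniform_pos ha))
    linarith [hδ1 (φ k)]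
  have hσ := G.pure_mem_randomizedActions ha
  by_cases hreach : 0 < G.infoReach π I
  · -- At a reached infoset, a gain in the limit would contradict the Nash property of `π`.
    have h1 : G.infoReach τ I = G.infoReach π I :=
      Finset.sum_congr rfl fun h hh => (hreal h (G.mem_nodes_of_mem_firstNodes hh)).symm
    have h2 : G.utility i (deviate τ I (Pi.single a 1)) - G.utility i τ ≤ 0 := by
      rw [← hreal.utility_eq i, sub_nonpos]
      exact hbest i _ (deviate_mem_profiles hτT.1 hσ) (hso.deviate hI _)
    have h3 : Tendsto (fun k => max 0 (1 / G.infoReach (p k) I *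
        (G.utility i (deviate (p k) I (Pi.single a 1)) - G.utility i (p k)))) atTop
        (𝓝 (max 0 (1 / G.infoReach τ I *
          (G.utility i (deviate τ I (Pi.single a 1)) - G.utility i τ)))) := by
      refine tendsto_const_nhds.max ((tendsto_const_nhds.div
        (((G.continuous_infoReach I).tendsto τ).comp hplim) ?_).mul
        (Tendsto.sub ?_ (((G.continuous_utility i).tendsto τ).comp hplim)))
      · rw [h1]; exact hreach.ne'
      · exact (((G.continuous_utility i).comp (continuous_deviate I _)).tendsto τ).comp hplim
    rwa [max_eq_left] at h3
    exact mul_nonpos_of_nonneg_of_nonpos (by rw [h1]; positivity) h2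
  · -- Elsewhere, optimality against the trembling version of the deviation leaves a gain of at most
    -- the order of the tremble, relative to the reach probability.
    set M := ∑ z ∈ G.terminals, G.payoff i z
    have hM0 : 0 ≤ M := Finset.sum_nonneg fun z hz => G.payoff_nonneg_of_mem hz
    have hbound : ∀ k, max 0 (1 / G.infoReach (p k) I *
        (G.utility i (deviate (p k) I (Pi.single a 1)) - G.utility i (p k))) ≤
        2 * δ (φ k) * M := by
      intro k
      have hd0 := hδ0 (φ k)
      have hd1 := hδ1 (φ k)
      have hR0 : 0 ≤ 2 * δ (φ k) * M := by positivity
      refine max_le hR0 ?_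
      have hmem : deviate (t (φ k)) I (Pi.single a 1) ∈ T := by
        refine ⟨deviate_mem_profiles (htT _).1 hσ, fun J hJ => ?_⟩
        rw [deviate_of_ne, (htT _).2 J hJ]
        rintro rfl
        exact hJ.elim (fun h => h hI) hreach
      have h1 := htmax (φ k) _ hmem
      rw [G.tremble_deviate hI, G.utility_deviate_convexComb hna] at h1
      have h2 := G.utility_sub_utility_deviate_le (i := i) (hpp k)
        (G.uniform_mem_randomizedActions I)
      rcases (G.infoReach_nonneg (hpp k) I).eq_or_lt with h0 | h0
      · rw [← h0]; simpa using hR0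
      rw [one_div, inv_mul_le_iff₀ h0]
      change (1 - δ (φ k)) * G.utility i (deviate (p k) I _) +
        δ (φ k) * G.utility i (deviate (p k) I _) ≤ G.utility i (p k) at h1
      have h3 : (1 - δ (φ k)) * (G.utility i (deviate (p k) I (Pi.single a 1)) -
          G.utility i (p k)) ≤ δ (φ k) * (G.infoReach (p k) I * M) := by
        have := mul_le_mul_of_nonneg_left h2 hd0.le
        linarith
      have h4 : 0 ≤ δ (φ k) * (G.infoReach (p k) I * M) := by positivity
      -- A positive gain is at most twice its multiple by `1 - δ`, as `δ ≤ 1 / 2`.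
      rcases le_total (G.utility i (deviate (p k) I (Pi.single a 1)) - G.utility i (p k)) 0
        with h5 | h5
      · linarith
      · nlinarith
    refine squeeze_zero (fun k => le_max_left _ _) hbound ?_
    simpa using ((hδlim.comp hφ.tendsto_atTop).const_mul 2).mul_const M

end ExtensiveGame

theorem mainTheorem9 {N Info A : Type*} [Finite N] [Nonempty N] (G : ExtensiveGame N Info A) :
    (∀ π : Info → A → ℝ, G.IsEDTNash π → G.IsEDTEquilibrium π) ∧
    (¬ G.HasAbsentmindedness → ∀ π : Info → A → ℝ, G.IsEDTNash π ↔ G.IsCDTNash π) ∧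
    (G.PerfectRecall → ∀ π : Info → A → ℝ, G.IsEDTNash π ↔ G.IsNash π) :=
  ⟨fun _ h => h.1, fun hna π => G.isEDTNash_iff_isCDTNash hna π, fun hpr _ =>
    ⟨fun h => h.isNash hpr, fun h => h.isEDTNash hpr.not_hasAbsentmindedness⟩⟩
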